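/- Let $d\ge 2$ be an integer, let $\beta>\frac d2$ be real, and let $k\in\{0,1,\dots,d-1\}$. A random point in $\mathbb{R}^d$ is beta-prime distributed (with parameter $\beta$) if it has the probability density $$\tilde f_{d,\beta}(x)=\frac{\Gamma(\beta)}{\pi^{d/2}\,\Gamma(\beta-\frac d2)}\,(1+\|x\|^2)^{-\beta},\qquad x\in\mathbb{R}^d,$$ where $\|\cdot\|$ is the Euclidean norm and $\Gamma$ is Euler's gamma function. Let $X_1,\dots,X_n$ be independent beta-prime distributed random points, let $\widetilde K_n^\beta$ be their convex hull, and let $f_k(\widetilde K_n^\beta)$ be the number of $k$-dimensional faces of this polytope. Then there is a constant $c>0$, depending only on $d$, $\beta$ and $k$, such that for every $n\ge d+2$ the random variable $f_k(\widetilde K_n^\beta)$ is square integrable and $$\mathrm{Var}\, f_k(\widetilde K_n^\beta)\ \ge\ c .$$ -/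

import Mathlib

open MeasureTheory ProbabilityTheory

noncomputable section

namespace BetaPrime

/-- The beta-prime density on `ℝ^d`, `x ↦ c (1 + ‖x‖²)^(-β)` with the normalizing constant
`c = Γ(β) / (π^(d/2) Γ(β - d/2))`; it is a probability density for `β > d/2`. -/
def density (d : ℕ) (β : ℝ) (x : EuclideanSpace ℝ (Fin d)) : ℝ :=
  Real.Gamma β / (Real.pi ^ ((d : ℝ) / 2) * Real.Gamma (β - (d : ℝ) / 2)) *
    (1 + ‖x‖ ^ 2) ^ (-β)

/-- The beta-prime distribution on `ℝ^d`: the measure with the density above with respect to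
Lebesgue measure. -/
def law (d : ℕ) (β : ℝ) : Measure (EuclideanSpace ℝ (Fin d)) :=
  volume.withDensity fun x => ENNReal.ofReal (density d β x)

/-- The polytope `[x_1, …, x_n]` spanned by finitely many points. -/
def polytope {d n : ℕ} (x : Fin n → EuclideanSpace ℝ (Fin d)) :
    Set (EuclideanSpace ℝ (Fin d)) :=
  convexHull ℝ (Set.range x)

/-- The set of `k`-dimensional faces of a convex set `K`. A face is a nonempty intersection of `K`
with a supporting hyperplane, i.e. the set of points of `K` where some linear functional attains
its maximum over `K` (the zero functional yields `K` itself); its dimension is the dimension of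
its affine hull. -/
def faces {d : ℕ} (k : ℕ) (K : Set (EuclideanSpace ℝ (Fin d))) :
    Set (Set (EuclideanSpace ℝ (Fin d))) :=
  {F | F.Nonempty ∧ IsExposed ℝ K F ∧ Module.finrank ℝ (vectorSpan ℝ F) = k}

/-- `f_k(K)`, the number of `k`-dimensional faces of the polytope `K`. -/
def faceCount {d : ℕ} (k : ℕ) (K : Set (EuclideanSpace ℝ (Fin d))) : ℕ :=
  (faces k K).ncard

end BetaPrime

end

/-!
The number of `k`-faces takes two different values with probability bounded below uniformly in `n`,
and this alone bounds its variance from below (`div_four_le_variance`).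

The beta-prime density decays like `‖x‖ ^ (-2β)`, so a dilation by `R` scales the probability of a
set away from the origin by a factor of order `R ^ (d - 2β)` (`rpow_mul_law_le`,
`law_compl_ball_le`). For `R` of order `n ^ (1 / (2β - d))` the expected number of sample points
outside a ball of radius proportional to `R` is bounded. Hence, for every fixed configuration of
`m` nonzero points, with probability bounded below there are `m` sample points close to the dilated
configuration while all others are comparatively close to the origin
(`exists_pos_le_measure_configuration`).

This applies to two configurations. The first consists of the standard basis vectors and `-𝟙`,
where `𝟙` is the all-ones vector. It spans a simplex around the origin, so the convex hull of the
sample is a simplex and has at most `(d + 1).choose (k + 1)` faces of dimension `k`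
(`eventually_faceCount_le`). The second consists of the standard basis vectors, `𝟙` and `-𝟙`, the
vertices of a bipyramid around the origin; its convex hull has strictly more `k`-faces
(`eventually_lt_faceCount`). Both statements are stable under small perturbations, since a
functional that exposes a face with linearly independent vertices can be adapted continuously to
perturbed vertices (`eventually_exists_functional`).

Faces are handled through index sets: a face of the convex hull of a finite family is determined by
the indices of the points that it contains (`faceCount_polytope`). This also gives measurability of
the face count (`measurable_faceCount_polytope`), which together with its boundedness yields square
integrability.
-/

namespace BetaPrime

open Filter Topology

/-! ### Faces of a polytope as index sets -/

section Faces

variable {d : ℕ} {ι : Type*}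

/-- `IsFaceIndexSet x J` says that some linear functional attains its maximum over the family `x`
exactly at the indices in `J`. The zero functional is allowed, so the set of all indices is a face
index set. -/
def IsFaceIndexSet (x : ι → EuclideanSpace ℝ (Fin d)) (J : Finset ι) : Prop :=
  ∃ (l : EuclideanSpace ℝ (Fin d) →L[ℝ] ℝ) (a : ℝ), (∀ i ∈ J, l (x i) = a) ∧ ∀ i ∉ J, l (x i) < a

variable {x : ι → EuclideanSpace ℝ (Fin d)} {J : Finset ι}
  {l : EuclideanSpace ℝ (Fin d) →L[ℝ] ℝ} {a : ℝ}

lemma apply_le_of_mem_convexHull (h : ∀ i, l (x i) ≤ a) {p : EuclideanSpace ℝ (Fin d)}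
    (hp : p ∈ convexHull ℝ (Set.range x)) : l p ≤ a :=
  convexHull_min (t := {q | l q ≤ a}) (by rintro _ ⟨i, rfl⟩; exact h i)
    (convex_halfSpace_le l.isLinear a) hp

lemma apply_eq_of_mem_convexHull_image (h : ∀ i ∈ J, l (x i) = a)
    {p : EuclideanSpace ℝ (Fin d)} (hp : p ∈ convexHull ℝ (x '' J)) : l p = a :=
  convexHull_min (t := {q | l q = a}) (by rintro _ ⟨i, hi, rfl⟩; exact h i hi)
    (convex_hyperplane l.isLinear a) hp

lemma mem_convexHull_image_of_le_apply (h₁ : ∀ i ∈ J, l (x i) = a) (h₂ : ∀ i ∉ J, l (x i) < a)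
    {p : EuclideanSpace ℝ (Fin d)} (hp : p ∈ convexHull ℝ (Set.range x)) (hpa : a ≤ l p) :
    p ∈ convexHull ℝ (x '' J) := by
  obtain ⟨κ, _, w, z, hw, hw1, hz, rfl⟩ := mem_convexHull_iff_exists_fintype.1 hp
  choose f hf using hz
  have hle : ∀ i, l (x i) ≤ a := fun i => by
    by_cases hi : i ∈ J
    · exact (h₁ i hi).le
    · exact (h₂ i hi).le
  have hterm : ∀ i, 0 ≤ w i * (a - l (z i)) := fun i =>
    mul_nonneg (hw i) (sub_nonneg.2 (by rw [← hf]; exact hle _))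
  -- the weighted deficits add up to `a - l p ≤ 0`, so each of them vanishes
  have hsum : ∑ i, w i * (a - l (z i)) ≤ 0 := by
    have : ∑ i, w i * (a - l (z i)) = a - l (∑ i, w i • z i) := by
      simp [mul_sub, Finset.sum_sub_distrib, ← Finset.sum_mul, hw1]
    linarith
  have hzero : ∀ i, w i * (a - l (z i)) = 0 := fun i =>
    (Finset.sum_eq_zero_iff_of_nonneg (fun i _ => hterm i)).1
      (le_antisymm hsum (Finset.sum_nonneg fun i _ => hterm i)) i (Finset.mem_univ i)
  rw [← Finset.sum_filter_of_ne (p := fun i => w i ≠ 0) (fun i _ hi h0 => hi (by simp [h0]))]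
  refine (convex_convexHull ℝ _).sum_mem (fun i _ => hw i)
    (by rw [Finset.sum_filter_ne_zero, hw1]) fun i hi => subset_convexHull ℝ _ ?_
  refine ⟨f i, ?_, hf i⟩
  by_contra hfi
  have := h₂ _ hfi
  rw [hf] at this
  exact (mul_ne_zero (Finset.mem_filter.1 hi).2 (sub_pos.2 this).ne') (hzero i)

lemma mem_convexHull_image_iff (h : IsFaceIndexSet x J) (i : ι) :
    x i ∈ convexHull ℝ (x '' J) ↔ i ∈ J := by
  obtain ⟨l, a, h₁, h₂⟩ := h
  refine ⟨fun hi => ?_, fun hi => subset_convexHull ℝ _ ⟨i, hi, rfl⟩⟩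
  by_contra hiJ
  exact (h₂ i hiJ).ne (apply_eq_of_mem_convexHull_image h₁ hi)

lemma IsFaceIndexSet.isExposed (h : IsFaceIndexSet x J) :
    IsExposed ℝ (convexHull ℝ (Set.range x)) (convexHull ℝ (x '' J)) := by
  obtain ⟨l, a, h₁, h₂⟩ := h
  rintro ⟨q, hq⟩
  have hle : ∀ i, l (x i) ≤ a := fun i => by
    by_cases hi : i ∈ J
    · exact (h₁ i hi).le
    · exact (h₂ i hi).le
  have hsub := convexHull_mono (𝕜 := ℝ) (Set.image_subset_range x J)
  refine ⟨l, Set.Subset.antisymm (fun p hp => ⟨hsub hp, fun y hy => ?_⟩) ?_⟩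
  · rw [apply_eq_of_mem_convexHull_image h₁ hp]
    exact apply_le_of_mem_convexHull hle hy
  · rintro p ⟨hp, hmax⟩
    refine mem_convexHull_image_of_le_apply h₁ h₂ hp ?_
    rw [← apply_eq_of_mem_convexHull_image h₁ hq]
    exact hmax q (hsub hq)

lemma exists_isFaceIndexSet [Finite ι] {F : Set (EuclideanSpace ℝ (Fin d))} (hne : F.Nonempty)
    (hF : IsExposed ℝ (convexHull ℝ (Set.range x)) F) :
    ∃ J : Finset ι, J.Nonempty ∧ IsFaceIndexSet x J ∧ F = convexHull ℝ (x '' J) := by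
  classical
  have := Fintype.ofFinite ι
  obtain ⟨l, hl⟩ := hF hne
  obtain ⟨q, hq⟩ := hne
  have hq' := hq
  rw [hl] at hq'
  set J : Finset ι := Finset.univ.filter fun i => l (x i) = l q
  have hle : ∀ i, l (x i) ≤ l q := fun i => hq'.2 _ (subset_convexHull ℝ _ ⟨i, rfl⟩)
  have h₁ : ∀ i ∈ J, l (x i) = l q := fun i hi => (Finset.mem_filter.1 hi).2
  have h₂ : ∀ i ∉ J, l (x i) < l q := fun i hi =>
    lt_of_le_of_ne (hle i) fun h => hi (Finset.mem_filter.2 ⟨Finset.mem_univ i, h⟩)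
  have hFJ : F = convexHull ℝ (x '' J) := by
    rw [hl]
    refine Set.Subset.antisymm (fun p hp => ?_) fun p hp =>
      ⟨convexHull_mono (Set.image_subset_range x J) hp, fun y hy => ?_⟩
    · exact mem_convexHull_image_of_le_apply h₁ h₂ hp.1 (hp.2 q hq'.1)
    · rw [apply_eq_of_mem_convexHull_image h₁ hp]
      exact apply_le_of_mem_convexHull hle hy
  refine ⟨J, ?_, ⟨l, l q, h₁, h₂⟩, hFJ⟩
  rw [hFJ] at hq
  simpa using convexHull_nonempty_iff.1 ⟨q, hq⟩

lemma vectorSpan_convexHull (s : Set (EuclideanSpace ℝ (Fin d))) :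
    vectorSpan ℝ (convexHull ℝ s) = vectorSpan ℝ s := by
  rw [← direction_affineSpan, affineSpan_convexHull, direction_affineSpan]

open Classical in
/-- The `k`-dimensional faces of a polytope correspond to the nonempty face index sets whose points
span an affine space of dimension `k`. -/
lemma faceCount_polytope {n : ℕ} (k : ℕ) (x : Fin n → EuclideanSpace ℝ (Fin d)) :
    faceCount k (polytope x) = (Finset.univ.filter fun J : Finset (Fin n) =>
      J.Nonempty ∧ IsFaceIndexSet x J ∧
        Module.finrank ℝ (vectorSpan ℝ (x '' (J : Set (Fin n)))) = k).card := by
  rw [faceCount, ← Set.ncard_coe_finset]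
  symm
  refine Set.ncard_congr (fun J _ => convexHull ℝ (x '' (J : Set (Fin n)))) ?_ ?_ ?_
  · intro J hJ
    simp only [Finset.coe_filter, Finset.mem_univ, true_and, Set.mem_ofPred_eq] at hJ
    exact ⟨by simpa using hJ.1, hJ.2.1.isExposed, by rw [vectorSpan_convexHull]; exact hJ.2.2⟩
  · intro J J' hJ hJ' h
    simp only [Finset.coe_filter, Finset.mem_univ, true_and, Set.mem_ofPred_eq] at hJ hJ'
    ext i
    rw [← mem_convexHull_image_iff hJ.2.1, ← mem_convexHull_image_iff hJ'.2.1]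
    exact iff_of_eq (congrArg (x i ∈ ·) h)
  · rintro F ⟨hne, hF, hk⟩
    obtain ⟨J, hJ, hfJ, rfl⟩ := exists_isFaceIndexSet hne hF
    refine ⟨J, ?_, rfl⟩
    simp only [Finset.coe_filter, Finset.mem_univ, true_and, Set.mem_ofPred_eq]
    exact ⟨hJ, hfJ, by rw [← vectorSpan_convexHull]; exact hk⟩

lemma faceCount_polytope_le_two_pow {n : ℕ} (k : ℕ) (x : Fin n → EuclideanSpace ℝ (Fin d)) :
    faceCount k (polytope x) ≤ 2 ^ n := by
  classical
  rw [faceCount_polytope]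
  exact (Finset.card_le_univ _).trans (by simp)

end Faces

/-! ### Measurability of the face count -/

section Measurability

variable {d : ℕ} {ι : Type*}

/-- Rescaling the functional turns the strict inequalities of a face index set into a gap of at
least `1`. This is a closed condition, which makes the set of configurations with a prescribed
face index set a countable union of closed sets. -/
lemma isFaceIndexSet_iff_exists_gap [Finite ι] {x : ι → EuclideanSpace ℝ (Fin d)}
    {J : Finset ι} :
    IsFaceIndexSet x J ↔ ∃ N : ℕ, ∃ q : Metric.closedBall
      (0 : (EuclideanSpace ℝ (Fin d) →L[ℝ] ℝ) × ℝ) N,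
      (∀ i ∈ J, q.1.1 (x i) = q.1.2) ∧ ∀ i ∉ J, q.1.1 (x i) + 1 ≤ q.1.2 := by
  constructor
  · rintro ⟨l, a, h₁, h₂⟩
    have hev : ∀ᶠ t : ℝ in atTop, ∀ i, i ∉ J → 1 ≤ t * (a - l (x i)) := by
      refine eventually_all.2 fun i => ?_
      by_cases hi : i ∈ J
      · simp [hi]
      · filter_upwards [(tendsto_id.atTop_mul_const (sub_pos.2 (h₂ i hi))).eventually_ge_atTop 1]
          with t ht _ using ht
    obtain ⟨t, ht⟩ := hev.exists
    obtain ⟨N, hN⟩ := exists_nat_ge ‖(t • l, t * a)‖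
    refine ⟨N, ⟨(t • l, t * a), by simpa using hN⟩, fun i hi => ?_, fun i hi => ?_⟩
    · simp [h₁ i hi]
    · have := ht i hi
      change t * l (x i) + 1 ≤ t * a
      linarith
  · rintro ⟨N, q, h₁, h₂⟩
    exact ⟨q.1.1, q.1.2, h₁, fun i hi => by linarith [h₂ i hi]⟩

lemma measurableSet_isFaceIndexSet [Finite ι] (J : Finset ι) :
    MeasurableSet {x : ι → EuclideanSpace ℝ (Fin d) | IsFaceIndexSet x J} := by
  simp only [isFaceIndexSet_iff_exists_gap, Set.ofPred_exists]
  refine MeasurableSet.iUnion fun N => IsClosed.measurableSet ?_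
  have : CompactSpace (Metric.closedBall (0 : (EuclideanSpace ℝ (Fin d) →L[ℝ] ℝ) × ℝ) N) :=
    isCompact_iff_compactSpace.1 (isCompact_closedBall _ _)
  have hcl : IsClosed {p : (ι → EuclideanSpace ℝ (Fin d)) ×
      Metric.closedBall (0 : (EuclideanSpace ℝ (Fin d) →L[ℝ] ℝ) × ℝ) N |
      (∀ i ∈ J, p.2.1.1 (p.1 i) = p.2.1.2) ∧ ∀ i ∉ J, p.2.1.1 (p.1 i) + 1 ≤ p.2.1.2} := by
    have hc : ∀ i, Continuous fun p : (ι → EuclideanSpace ℝ (Fin d)) ×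
        Metric.closedBall (0 : (EuclideanSpace ℝ (Fin d) →L[ℝ] ℝ) × ℝ) N =>
        p.2.1.1 (p.1 i) := fun i => by fun_prop
    simp only [Set.ofPred_and, Set.ofPred_forall]
    refine IsClosed.inter (isClosed_iInter fun i => isClosed_iInter fun _ => ?_)
      (isClosed_iInter fun i => isClosed_iInter fun _ => ?_)
    · exact isClosed_eq (hc i) (by fun_prop)
    · exact isClosed_le ((hc i).add continuous_const) (by fun_prop)
  convert isClosedMap_fst_of_compactSpace _ hcl using 1
  ext x
  simp

lemma isOpen_le_finrank_vectorSpan_image {J : Finset ι} (hJ : J.Nonempty) (r : ℕ) :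
    IsOpen {x : ι → EuclideanSpace ℝ (Fin d) |
      r ≤ Module.finrank ℝ (vectorSpan ℝ (x '' (J : Set ι)))} := by
  obtain ⟨j, hj⟩ := hJ
  set A : (ι → EuclideanSpace ℝ (Fin d)) → ((J → ℝ) →L[ℝ] EuclideanSpace ℝ (Fin d)) :=
    fun x => ∑ i : J, (ContinuousLinearMap.proj i).smulRight (x i - x j)
  have hA : Continuous A := by
    refine continuous_finsetSum _ fun i _ => ?_
    have h : Continuous fun x : ι → EuclideanSpace ℝ (Fin d) => x i - x j := by fun_prop
    exact (ContinuousLinearMap.smulRightL ℝ (J → ℝ) (EuclideanSpace ℝ (Fin d))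
      (ContinuousLinearMap.proj i)).continuous.comp h
  have hrange : ∀ x, vectorSpan ℝ (x '' (J : Set ι)) =
      LinearMap.range (A x : (J → ℝ) →ₗ[ℝ] EuclideanSpace ℝ (Fin d)) := fun x => by
    have h1 : (A x : (J → ℝ) →ₗ[ℝ] EuclideanSpace ℝ (Fin d)) =
        Fintype.linearCombination ℝ fun i : J => x i - x j := by
      ext i
      simp [A, Fintype.linearCombination_apply]
    rw [h1, Fintype.range_linearCombination,
      vectorSpan_eq_span_vsub_set_right ℝ (Set.mem_image_of_mem x hj)]
    congr 1
    ext v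
    simp
  convert (isOpen_setOfPred_nat_le_rank r).preimage hA using 1
  ext x
  simp only [Set.mem_ofPred_eq, Set.mem_preimage, LinearMap.rank,
    ← Module.finrank_eq_rank, Nat.cast_le]
  rw [hrange x]

lemma measurable_faceCount_polytope (k n : ℕ) :
    Measurable fun x : Fin n → EuclideanSpace ℝ (Fin d) => faceCount k (polytope x) := by
  classical
  simp only [faceCount_polytope, Finset.card_filter]
  refine Finset.measurable_sum _ fun J _ => Measurable.ite ?_ measurable_const measurable_const
  by_cases hJ : J.Nonempty
  · have hk : MeasurableSet {x : Fin n → EuclideanSpace ℝ (Fin d) |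
        Module.finrank ℝ (vectorSpan ℝ (x '' (J : Set (Fin n)))) = k} := by
      have := (isOpen_le_finrank_vectorSpan_image (d := d) hJ k).measurableSet.diff
        (isOpen_le_finrank_vectorSpan_image (d := d) hJ (k + 1)).measurableSet
      convert this using 1
      ext x
      simp only [Set.mem_ofPred_eq, Set.mem_sdiff]
      omega
    simp only [hJ, true_and]
    exact (measurableSet_isFaceIndexSet J).inter hk
  · simp [hJ]

end Measurability

/-! ### Stability of faces under perturbation -/

section Stability

variable {d : ℕ} {ι : Type*}

/-- If the points `y i`, `i ∈ J`, are linearly independent and `l₀` is a functional that is equal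
to `1` exactly on them and smaller on the other points of the configuration, then after a small
perturbation of `y` there still is such a functional. It can be chosen close to `l₀`, hence it
stays below `1` on a fixed neighbourhood of the origin. -/
lemma eventually_exists_functional [Finite ι] {y : ι → EuclideanSpace ℝ (Fin d)} {J : Finset ι}
    (hy : LinearIndependent ℝ fun i : J => y i) (l₀ : EuclideanSpace ℝ (Fin d) →L[ℝ] ℝ)
    (h₁ : ∀ i ∈ J, l₀ (y i) = 1) (h₂ : ∀ i ∉ J, l₀ (y i) < 1) :
    ∀ᶠ x in 𝓝 y, LinearIndependent ℝ (fun i : J => x i) ∧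
      ∃ l : EuclideanSpace ℝ (Fin d) →L[ℝ] ℝ, ‖l‖ < ‖l₀‖ + 1 ∧
        (∀ i ∈ J, l (x i) = 1) ∧ ∀ i ∉ J, l (x i) < 1 := by
  classical
  have := Fintype.ofFinite ι
  have hlin : ∀ᶠ x in 𝓝 y, LinearIndependent ℝ (fun i : J => x i) :=
    (isOpen_setOfPred_linearIndependent.preimage (f := fun (x : ι → EuclideanSpace ℝ (Fin d))
      (i : J) => x i) (by fun_prop)).mem_nhds hy
  set A : (ι → EuclideanSpace ℝ (Fin d)) → ((J → ℝ) →L[ℝ] EuclideanSpace ℝ (Fin d)) :=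
    fun x => ∑ i : J, (ContinuousLinearMap.proj i).smulRight (x i)
  have hA : Continuous A := by
    refine continuous_finsetSum _ fun i _ => ?_
    have h : Continuous fun x : ι → EuclideanSpace ℝ (Fin d) => x i := by fun_prop
    exact (ContinuousLinearMap.smulRightL ℝ (J → ℝ) (EuclideanSpace ℝ (Fin d))
      (ContinuousLinearMap.proj i)).continuous.comp h
  have hAlin : ∀ x, (A x : (J → ℝ) →ₗ[ℝ] EuclideanSpace ℝ (Fin d)) =
      Fintype.linearCombination ℝ fun i : J => x i := fun x => by
    ext i
    simp [A, Fintype.linearCombination_apply]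
  have hAs : ∀ x (i : J), A x (Pi.single i 1) = x i := fun x i => by
    have := congrArg (fun f => f (Pi.single i 1)) (hAlin x)
    simpa using this
  -- a left inverse `B` of the injective map `A y`
  obtain ⟨B', hB'⟩ := (A y : (J → ℝ) →ₗ[ℝ] EuclideanSpace ℝ (Fin d)).exists_leftInverse_of_injective
    (by
      rw [hAlin]
      exact LinearMap.ker_eq_bot.2 (linearIndependent_iff_injective_fintypeLinearCombination.1 hy))
  set B : EuclideanSpace ℝ (Fin d) →L[ℝ] (J → ℝ) := LinearMap.toContinuousLinearMap B'
  have hBA : B.comp (A y) = 1 := by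
    ext1 c
    exact congrArg (fun f => f c) hB'
  set ones : (J → ℝ) →L[ℝ] ℝ := ∑ i : J, ContinuousLinearMap.proj i
  have hones : ∀ i : J, ones (Pi.single i 1) = 1 := fun i => by
    simp [ones]
  -- correct `l₀` so that it takes the value `1` on the perturbed points `x i`, `i ∈ J`
  set lx : (ι → EuclideanSpace ℝ (Fin d)) → (EuclideanSpace ℝ (Fin d) →L[ℝ] ℝ) := fun x =>
    l₀ + (ones - l₀.comp (A x)).comp ((Ring.inverse (B.comp (A x))).comp B)
  have hzero : ones - l₀.comp (A y) = 0 := by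
    apply ContinuousLinearMap.coe_injective
    ext i
    simp [hones, hAs, h₁ i i.2]
  have hlxy : lx y = l₀ := by
    simp only [lx, hzero]
    ext
    simp
  have hBAc : Continuous fun x => B.comp (A x) := by fun_prop
  have hcont : ContinuousAt lx y := by
    have hinv : ContinuousAt (fun x => Ring.inverse (B.comp (A x))) y := by
      have h := NormedRing.inverse_continuousAt (1 : ((J → ℝ) →L[ℝ] (J → ℝ))ˣ)
      rw [Units.val_one, ← hBA] at h
      exact ContinuousAt.comp (f := fun x => B.comp (A x)) h hBAc.continuousAt
    have h1 : ContinuousAt (fun x => ones - l₀.comp (A x)) y := by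
      have : Continuous fun x => ones - l₀.comp (A x) := by fun_prop
      exact this.continuousAt
    exact continuousAt_const.add (h1.clm_comp (hinv.clm_comp continuousAt_const))
  have hunit : ∀ᶠ x in 𝓝 y, IsUnit (B.comp (A x)) := by
    refine hBAc.continuousAt.eventually (Units.isOpen.mem_nhds ?_)
    change IsUnit (B.comp (A y))
    rw [hBA]
    exact isUnit_one
  have hnorm : ∀ᶠ x in 𝓝 y, ‖lx x‖ < ‖l₀‖ + 1 := by
    refine hcont.norm.eventually_lt continuousAt_const ?_
    rw [hlxy]
    linarith
  have hlt : ∀ᶠ x in 𝓝 y, ∀ i, i ∉ J → lx x (x i) < 1 := by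
    refine eventually_all.2 fun i => ?_
    by_cases hi : i ∈ J
    · simp [hi]
    · have : ContinuousAt (fun x => lx x (x i)) y :=
        hcont.clm_apply (continuous_apply i).continuousAt
      filter_upwards [this.eventually_lt continuousAt_const
        (by simpa only [hlxy] using h₂ i hi)] with x hx _ using hx
  filter_upwards [hlin, hunit, hnorm, hlt] with x hx hu hn hl
  refine ⟨hx, lx x, hn, fun i hi => ?_, hl⟩
  have hinv : Ring.inverse (B.comp (A x)) (B (x i)) = Pi.single (⟨i, hi⟩ : J) 1 := by
    have h := congrArg (fun f => f (Pi.single (⟨i, hi⟩ : J) 1)) (Ring.inverse_mul_cancel _ hu)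
    simpa [hAs] using h
  simp [lx, hinv, hones, hAs]

/-- A form of `eventually_exists_functional` for a dilate of the configuration `y`, perturbed,
together with further points near the origin. -/
lemma eventually_radius_exists_functional [Fintype ι] {y : ι → EuclideanSpace ℝ (Fin d)}
    {J : Finset ι}
    (hy : LinearIndependent ℝ fun i : J => y i) (l₀ : EuclideanSpace ℝ (Fin d) →L[ℝ] ℝ)
    (h₁ : ∀ i ∈ J, l₀ (y i) = 1) (h₂ : ∀ i ∉ J, l₀ (y i) < 1) :
    ∀ᶠ δ : ℝ in 𝓝[>] 0, ∀ (x : ι → EuclideanSpace ℝ (Fin d)) (R : ℝ), 0 < R →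
      (∀ i, dist (x i) (R • y i) < R * δ) →
      LinearIndependent ℝ (fun i : J => x i) ∧
      ∃ l : EuclideanSpace ℝ (Fin d) →L[ℝ] ℝ,
        (∀ i ∈ J, l (x i) = 1) ∧ (∀ i ∉ J, l (x i) < 1) ∧ ∀ z, ‖z‖ < R * δ → l z < 1 := by
  obtain ⟨ε, hε, h⟩ := Metric.eventually_nhds_iff.1 (eventually_exists_functional hy l₀ h₁ h₂)
  have hpos : 0 < (‖l₀‖ + 1)⁻¹ := by positivity
  filter_upwards [Ioo_mem_nhdsGT hε, Ioo_mem_nhdsGT hpos] with δ hδ hδ' x R hR hx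
  have hdist : dist (R⁻¹ • x) y < ε := by
    refine ((dist_pi_lt_iff hδ.1).2 fun i => ?_).trans hδ.2
    have : (R⁻¹ • x) i = R⁻¹ • x i := rfl
    rw [this, ← inv_smul_smul₀ hR.ne' (y i), dist_smul₀, Real.norm_of_nonneg (by positivity)]
    rw [inv_mul_lt_iff₀ hR]
    exact hx i
  obtain ⟨hlin, l, hl, hl₁, hl₂⟩ := h hdist
  refine ⟨?_, R⁻¹ • l, fun i hi => ?_, fun i hi => ?_, fun z hz => ?_⟩
  · convert hlin.units_smul fun _ => Units.mk0 R hR.ne' using 1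
    ext1 i
    exact (smul_inv_smul₀ hR.ne' (x i)).symm
  · rw [← hl₁ i hi]
    exact (map_smul l R⁻¹ (x i)).symm
  · refine lt_of_eq_of_lt ?_ (hl₂ i hi)
    exact (map_smul l R⁻¹ (x i)).symm
  · have hz' : R⁻¹ * ‖z‖ < (‖l₀‖ + 1)⁻¹ := by
      rw [inv_mul_lt_iff₀ hR]
      exact hz.trans (mul_lt_mul_of_pos_left hδ'.2 hR)
    calc (R⁻¹ • l) z = R⁻¹ * l z := rfl
      _ ≤ R⁻¹ * (‖l‖ * ‖z‖) := by
          gcongr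
          exact (Real.le_norm_self _).trans (l.le_opNorm z)
      _ ≤ R⁻¹ * ((‖l₀‖ + 1) * ‖z‖) := by gcongr
      _ = (‖l₀‖ + 1) * (R⁻¹ * ‖z‖) := by ring
      _ < (‖l₀‖ + 1) * (‖l₀‖ + 1)⁻¹ := by gcongr
      _ = 1 := mul_inv_cancel₀ (by positivity)

end Stability

/-! ### Bounding the face count of a simplex and of a perturbed configuration -/

section Counting

variable {d n : ℕ}

lemma finrank_vectorSpan_image_of_affineIndependent {ι : Type*} {x : ι → EuclideanSpace ℝ (Fin d)}
    {J : Finset ι} (hJ : J.Nonempty) (h : AffineIndependent ℝ fun i : J => x i) :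
    Module.finrank ℝ (vectorSpan ℝ (x '' (J : Set ι))) + 1 = J.card := by
  have hr : x '' (J : Set ι) = Set.range fun i : J => x i := Set.image_eq_range _ _
  have hc : Fintype.card J = (J.card - 1) + 1 := by
    have := hJ.card_pos
    simp only [Fintype.card_coe]
    omega
  rw [hr, h.finrank_vectorSpan hc]
  simpa using hc.symm

/-- Points with facet functionals are affinely independent. -/
lemma affineIndependent_of_facet_functionals {ι : Type*} {v : ι → EuclideanSpace ℝ (Fin d)}
    (g : ι → EuclideanSpace ℝ (Fin d) →L[ℝ] ℝ) (h₁ : ∀ i j, j ≠ i → g i (v j) = 1)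
    (h₂ : ∀ i, g i (v i) < 1) : AffineIndependent ℝ v := by
  refine affineIndependent_iff.2 fun s w hw hwx i hi => ?_
  have h0 : ∑ e ∈ s, w e * (1 - g i (v e)) = 0 := by
    have := congrArg (g i) hwx
    simp only [map_sum, map_smul, smul_eq_mul, map_zero] at this
    simp [mul_sub, Finset.sum_sub_distrib, hw, this]
  rw [Finset.sum_eq_single i (fun e _ hei => by rw [h₁ i e hei]; simp)
    (fun h => absurd hi h)] at h0
  exact (mul_eq_zero.1 h0).resolve_right (sub_pos.2 (h₂ i)).ne'

/-- A point below `1` for all facet functionals of a simplex has positive barycentric coordinates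
`w`. -/
lemma exists_pos_weights_of_facet_functionals {ι : Type*} [Fintype ι]
    (hι : Fintype.card ι = d + 1) {v : ι → EuclideanSpace ℝ (Fin d)}
    (g : ι → EuclideanSpace ℝ (Fin d) →L[ℝ] ℝ) (h₁ : ∀ i j, j ≠ i → g i (v j) = 1)
    (h₂ : ∀ i, g i (v i) < 1) {z : EuclideanSpace ℝ (Fin d)} (hz : ∀ i, g i z < 1) :
    ∃ w : ι → ℝ, (∀ i, 0 < w i) ∧ ∑ i, w i = 1 ∧ ∑ i, w i • v i = z := by
  have hind := affineIndependent_of_facet_functionals g h₁ h₂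
  obtain ⟨b, hb⟩ : ∃ b : AffineBasis ι ℝ (EuclideanSpace ℝ (Fin d)), ∀ i, b i = v i :=
    ⟨⟨v, hind, hind.affineSpan_eq_top_iff_card_eq_finrank_add_one.2 (by simpa using hι)⟩,
      fun _ => rfl⟩
  have hsum : ∑ i, b.coord i z = 1 := b.sum_coord_apply_eq_one z
  have hlin : ∑ i, b.coord i z • v i = z := by
    simpa only [hb] using b.linear_combination_coord_eq_self z
  refine ⟨fun i => b.coord i z, fun i => ?_, hsum, hlin⟩
  have h : 1 - g i z = ∑ e, b.coord e z * (1 - g i (v e)) := by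
    have h1 := congrArg (g i) hlin
    simp only [map_sum, map_smul, smul_eq_mul] at h1
    simp only [mul_sub, Finset.sum_sub_distrib, mul_one, hsum, h1]
  rw [Finset.sum_eq_single i (fun e _ hei => by rw [h₁ i e hei]; simp)
    (fun h => absurd (Finset.mem_univ i) h)] at h
  refine pos_of_mul_pos_left (b := 1 - g i (v i)) ?_ (sub_pos.2 (h₂ i)).le
  rw [← h]
  exact sub_pos.2 (hz i)

/-- If `d + 1` of the points have facet functionals that stay below `1` at all remaining points,
these `d + 1` points span a simplex that contains all remaining points in its interior. So the
`k`-faces of the polytope are among those spanned by `k + 1` of the `d + 1` points. -/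
lemma faceCount_le_of_facet_functionals {x : Fin n → EuclideanSpace ℝ (Fin d)}
    {S : Finset (Fin n)} (hS : S.card = d + 1)
    (h : ∀ i : S, ∃ l : EuclideanSpace ℝ (Fin d) →L[ℝ] ℝ,
      (∀ j : S, j ≠ i → l (x j) = 1) ∧ l (x i) < 1 ∧ ∀ j ∉ S, l (x j) < 1)
    {k : ℕ} (hk : k < d) :
    faceCount k (polytope x) ≤ (d + 1).choose (k + 1) := by
  classical
  choose g hg₁ hg₂ hg₃ using h
  have hind : AffineIndependent ℝ fun i : S => x i :=
    affineIndependent_of_facet_functionals g hg₁ hg₂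
  have hcard : Fintype.card S = d + 1 := by simpa using hS
  rw [faceCount_polytope, ← hS, ← Finset.card_powersetCard]
  refine Finset.card_le_card fun J hJ => ?_
  obtain ⟨hJne, ⟨l, a, hl₁, hl₂⟩, hJk⟩ := (Finset.mem_filter.1 hJ).2
  have hle : ∀ i, 0 ≤ a - l (x i) := fun i => by
    by_cases hi : i ∈ J
    · exact (sub_eq_zero.2 (hl₁ i hi).symm).ge
    · exact (sub_pos.2 (hl₂ i hi)).le
  have hJS : J ⊆ S := by
    by_contra hJS
    obtain ⟨j, hjJ, hjS⟩ := Finset.not_subset.1 hJS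
    obtain ⟨w, hw, hw1, hwx⟩ := exists_pos_weights_of_facet_functionals hcard g hg₁ hg₂
      (z := x j) fun i => hg₃ i j hjS
    have h1 : ∑ i : S, w i * (a - l (x i)) = 0 := by
      have h2 := congrArg l hwx
      simp only [map_sum, map_smul, smul_eq_mul] at h2
      simp only [mul_sub, Finset.sum_sub_distrib, ← Finset.sum_mul, hw1, h2, hl₁ j hjJ, one_mul,
        sub_self]
    -- a face through an interior point of the simplex contains the whole simplex
    have hSJ : S ⊆ J := fun i hi => by
      by_contra hiJ
      have h2 := (Finset.sum_eq_zero_iff_of_nonneg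
        (fun e _ => mul_nonneg (hw e).le (hle e))).1 h1 ⟨i, hi⟩ (Finset.mem_univ _)
      exact (mul_pos (hw ⟨i, hi⟩) (sub_pos.2 (hl₂ i hiJ))).ne' h2
    have hSne : S.Nonempty := Finset.card_pos.1 (by omega)
    have h2 := finrank_vectorSpan_image_of_affineIndependent hSne hind
    have h3 := Submodule.finrank_mono (vectorSpan_mono ℝ
      (Set.image_mono (f := x) (Finset.coe_subset.2 hSJ)))
    omega
  refine Finset.mem_powersetCard.2 ⟨hJS, ?_⟩
  have hindJ : AffineIndependent ℝ fun i : J => x i :=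
    hind.comp_embedding (Function.Embedding.subtypeMap (.refl _) hJS)
  rw [← finrank_vectorSpan_image_of_affineIndependent hJne hindJ, hJk]

lemma card_le_faceCount {ι : Type*} {x : Fin n → EuclideanSpace ℝ (Fin d)} (σ : ι ↪ Fin n)
    {k : ℕ} (𝒥 : Finset (Finset ι)) (hcard : ∀ J ∈ 𝒥, J.card = k + 1)
    (hface : ∀ J ∈ 𝒥, IsFaceIndexSet x (J.map σ))
    (hind : ∀ J ∈ 𝒥, AffineIndependent ℝ fun i : J => x (σ i)) :
    𝒥.card ≤ faceCount k (polytope x) := by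
  classical
  rw [faceCount_polytope, ← Finset.card_map (Finset.mapEmbedding σ).toEmbedding]
  refine Finset.card_le_card fun J' hJ' => ?_
  obtain ⟨J, hJ, rfl⟩ := Finset.mem_map.1 hJ'
  have hne : J.Nonempty := Finset.card_pos.1 (by rw [hcard J hJ]; omega)
  refine Finset.mem_filter.2 ⟨Finset.mem_univ _, by simpa using hne, hface J hJ, ?_⟩
  have h := finrank_vectorSpan_image_of_affineIndependent (x := fun i => x (σ i)) hne (hind J hJ)
  rw [hcard J hJ] at h
  have himg : x '' ((J.map σ : Finset (Fin n)) : Set (Fin n)) =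
      (fun i => x (σ i)) '' (J : Set ι) := by
    rw [Finset.coe_map, Set.image_image]
  change Module.finrank ℝ (vectorSpan ℝ (x '' ((J.map σ : Finset (Fin n)) : Set (Fin n)))) = k
  rw [himg]
  omega

end Counting

/-! ### The two configurations -/

section Configurations

variable {d n : ℕ} {κ : Type*}

/-- The configuration consisting of the standard basis vectors of `ℝ^d` and the multiples `s t` of
the all-ones vector. -/
noncomputable def configuration (d : ℕ) (s : κ → ℝ) :
    Fin d ⊕ κ → EuclideanSpace ℝ (Fin d) :=
  Sum.elim (fun i => EuclideanSpace.single i 1) fun t => s t • WithLp.toLp 2 fun _ => 1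

/-- A set of basis vectors together with at most one nonzero multiple of the all-ones vector is
linearly independent, unless it has `d + 1` elements. -/
lemma linearIndependent_configuration {s : κ → ℝ} (hs : ∀ t, s t ≠ 0) (I : Finset (Fin d))
    {T : Finset κ} (hT : T.card ≤ 1) (hIT : I ≠ Finset.univ ∨ T = ∅) :
    LinearIndependent ℝ fun i : I.disjSum T => configuration d s i := by
  refine (linearIndepOn_finset_iff (v := configuration d s) (s := I.disjSum T)).2 fun f hf => ?_
  rw [Finset.sum_disjSum] at hf
  have hcoord : ∀ m, (if m ∈ I then f (Sum.inl m) else 0) + ∑ t ∈ T, f (Sum.inr t) * s t = 0 :=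
    fun m => by
      have := congrArg (fun v : EuclideanSpace ℝ (Fin d) => v m) hf
      simpa [configuration, Finset.sum_apply, Pi.single_apply] using this
  have hsum : ∑ t ∈ T, f (Sum.inr t) * s t = 0 := by
    rcases hIT with hI | rfl
    · obtain ⟨m, hm⟩ : ∃ m, m ∉ I := by
        by_contra! h
        exact hI (Finset.eq_univ_iff_forall.2 h)
      simpa [hm] using hcoord m
    · simp
  rintro (i | t) hi
  · have := hcoord i
    rw [hsum, if_pos (by simpa using hi), add_zero] at this
    exact this
  · have ht : t ∈ T := by simpa using hi
    rw [Finset.sum_eq_single t (fun t' ht' hne => absurd (Finset.card_le_one.1 hT t' ht' t ht) hne)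
      (fun h => absurd ht h)] at hsum
    exact (mul_eq_zero.1 hsum).resolve_right (hs t)

/-- The functional with the prescribed coordinates, evaluated at the configuration. -/
lemma exists_functional_configuration (s : κ → ℝ) (c : Fin d → ℝ) :
    ∃ l : EuclideanSpace ℝ (Fin d) →L[ℝ] ℝ,
      (∀ i, l (configuration d s (Sum.inl i)) = c i) ∧
        ∀ t, l (configuration d s (Sum.inr t)) = s t * ∑ i, c i := by
  refine ⟨∑ i, c i • EuclideanSpace.proj i, fun i => ?_, fun t => ?_⟩
  · simp [configuration]
  · simp [configuration, Finset.mul_sum]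

/-- For a proper subset `I` of the basis vectors and `a < d` there is a functional that is `1`
exactly on `I`, smaller on the other basis vectors, and has coordinate sum `a`. -/
lemma exists_functional_of_ne_univ (s : κ → ℝ) {I : Finset (Fin d)} (hI : I ≠ Finset.univ)
    {a : ℝ} (ha : a < d) :
    ∃ l : EuclideanSpace ℝ (Fin d) →L[ℝ] ℝ,
      (∀ i ∈ I, l (configuration d s (Sum.inl i)) = 1) ∧
      (∀ i ∉ I, l (configuration d s (Sum.inl i)) < 1) ∧
        ∀ t, l (configuration d s (Sum.inr t)) = s t * a := by
  classical
  have hlt : (I.card : ℝ) < d := by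
    have := (Finset.card_lt_iff_ne_univ I).2 hI
    rw [Fintype.card_fin] at this
    exact_mod_cast this
  obtain ⟨l, hl₁, hl₂⟩ := exists_functional_configuration s
    fun i => if i ∈ I then 1 else (a - I.card) / (d - I.card)
  refine ⟨l, fun i hi => by simp [hl₁, hi], fun i hi => ?_, fun t => ?_⟩
  · rw [hl₁, if_neg hi, div_lt_one (by linarith)]
    linarith
  · rw [hl₂, Finset.sum_ite]
    have hfil : Finset.univ.filter (fun i => i ∉ I) = Iᶜ := by ext; simp
    simp only [Finset.sum_const, nsmul_eq_mul, hfil, Finset.card_compl, Fintype.card_fin,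
      Finset.filter_mem_eq_inter, Finset.univ_inter, mul_one]
    rw [Nat.cast_sub (by exact_mod_cast hlt.le)]
    have : (d : ℝ) - I.card ≠ 0 := by linarith
    field_simp
    ring

/-- `d + 1` points near the vertices of a dilated simplex around the origin and all others near the
origin: the simplex contains the other points in its interior. -/
lemma eventually_faceCount_le (hd : 0 < d) {k : ℕ} (hk : k < d) :
    ∀ᶠ δ : ℝ in 𝓝[>] 0, ∀ (n : ℕ) (x : Fin n → EuclideanSpace ℝ (Fin d)) (R : ℝ)
      (σ : Fin d ⊕ Unit ↪ Fin n), 0 < R →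
      (∀ i, dist (x (σ i)) (R • configuration d (fun _ => -1) i) < R * δ) →
      (∀ j ∉ Set.range σ, ‖x j‖ < R * δ) →
      faceCount k (polytope x) ≤ (d + 1).choose (k + 1) := by
  classical
  set y : Fin d ⊕ Unit → EuclideanSpace ℝ (Fin d) := configuration d fun _ => -1
  have hd' : (0 : ℝ) < d := by exact_mod_cast hd
  have hfacet : ∀ i : Fin d ⊕ Unit, ∃ (I : Finset (Fin d)) (T : Finset Unit),
      (Finset.univ.erase i = I.disjSum T) ∧ (I ≠ Finset.univ ∨ T = ∅) ∧
      ∃ l : EuclideanSpace ℝ (Fin d) →L[ℝ] ℝ,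
        (∀ j ∈ I.disjSum T, l (y j) = 1) ∧ ∀ j ∉ I.disjSum T, l (y j) < 1 := by
    rintro (i | t)
    · have hne : Finset.univ.erase i ≠ Finset.univ := fun h =>
        Finset.notMem_erase i Finset.univ (h.symm ▸ Finset.mem_univ i)
      obtain ⟨l, hl₁, hl₂, hl₃⟩ := exists_functional_of_ne_univ (fun _ : Unit => (-1 : ℝ)) hne
        (a := -1) (by linarith)
      refine ⟨Finset.univ.erase i, Finset.univ, by ext (j | j) <;> simp, Or.inl hne, l, ?_, ?_⟩
      · rintro (j | j) hj
        · exact hl₁ j (by simpa using hj)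
        · simp [y, hl₃]
      · rintro (j | j) hj
        · exact hl₂ j (by simpa using hj)
        · simp at hj
    · obtain ⟨l, hl₁, hl₂⟩ := exists_functional_configuration (fun _ : Unit => (-1 : ℝ))
        fun _ : Fin d => (1 : ℝ)
      refine ⟨Finset.univ, ∅, by ext (j | j) <;> simp, Or.inr rfl, l, ?_, ?_⟩
      · rintro (j | j) hj
        · exact hl₁ j
        · simp at hj
      · rintro (j | j) hj
        · simp at hj
        · simp only [y, hl₂]
          simp
          linarith
  choose I T hIT hne l₀ hl₁ hl₂ using hfacet
  have hev := eventually_all.2 fun i => eventually_radius_exists_functional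
    (linearIndependent_configuration (s := fun _ : Unit => (-1 : ℝ)) (by simp) (I i) (T := T i)
      (Finset.card_le_univ _) (hne i)) (l₀ i) (hl₁ i) (hl₂ i)
  filter_upwards [hev] with δ hδ n x R σ hR hx hz
  refine faceCount_le_of_facet_functionals (S := Finset.univ.map σ) (by simp) ?_ hk
  rintro ⟨i', hi'⟩
  obtain ⟨i, -, rfl⟩ := Finset.mem_map.1 hi'
  obtain ⟨-, l, h₁, h₂, h₃⟩ := hδ i (fun j => x (σ j)) R hR hx
  rw [← hIT] at h₁ h₂
  refine ⟨l, ?_, h₂ i (by simp), fun j hj => h₃ _ (hz j ?_)⟩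
  · rintro ⟨j', hj'⟩ hne
    obtain ⟨j, -, rfl⟩ := Finset.mem_map.1 hj'
    exact h₁ j (by simpa using hne)
  · simpa using hj

/-- The index sets of the `k`-faces of the bipyramid spanned by the standard basis vectors and `±`
the all-ones vector: at most one apex, and not all basis vectors. -/
def bipyramidFaces (d k : ℕ) : Finset (Finset (Fin d ⊕ Bool)) :=
  (((Finset.univ : Finset (Finset (Fin d))).filter (· ≠ Finset.univ) ×ˢ
    (Finset.univ : Finset (Finset Bool)).filter (·.card ≤ 1)).image
      fun p => p.1.disjSum p.2).filter (·.card = k + 1)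

lemma mem_bipyramidFaces {k : ℕ} {J : Finset (Fin d ⊕ Bool)} :
    J ∈ bipyramidFaces d k ↔ ∃ I T, I ≠ Finset.univ ∧ T.card ≤ 1 ∧
      J = Finset.disjSum I T ∧ J.card = k + 1 := by
  simp only [bipyramidFaces, Finset.mem_filter, Finset.mem_image, Finset.mem_product,
    Finset.mem_univ, true_and, Prod.exists]
  constructor
  · rintro ⟨⟨I, T, ⟨hI, hT⟩, rfl⟩, h⟩
    exact ⟨I, T, hI, hT, rfl, h⟩
  · rintro ⟨I, T, hI, hT, rfl, h⟩
    exact ⟨⟨I, T, ⟨hI, hT⟩, rfl⟩, h⟩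

/-- The bipyramid has more `k`-faces than the simplex of the same dimension. -/
lemma choose_lt_card_bipyramidFaces (hd : 2 ≤ d) {k : ℕ} (hk : k < d) :
    (d + 1).choose (k + 1) < (bipyramidFaces d k).card := by
  classical
  have hdisj : Function.Injective fun p : Finset (Fin d) × Finset Bool => p.1.disjSum p.2 := by
    rintro ⟨I, T⟩ ⟨I', T'⟩ h
    have h1 := congrArg Finset.toLeft h
    have h2 := congrArg Finset.toRight h
    simpa using And.intro h1 h2
  have hne : ∀ (I : Finset (Fin d)), I.card < d → I ≠ Finset.univ := fun I hI h => by
    simp [h] at hI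
  -- faces with an apex
  set A := Finset.powersetCard k (Finset.univ : Finset (Fin d)) ×ˢ
    ({{true}, {false}} : Finset (Finset Bool))
  have hA : A.card = d.choose k * 2 := by
    simp [A, Finset.card_product]
  have hmemA : ∀ p ∈ A, p.1.disjSum p.2 ∈ bipyramidFaces d k := by
    rintro ⟨I, T⟩ hp
    simp only [A, Finset.mem_product, Finset.mem_powersetCard_univ, Finset.mem_insert,
      Finset.mem_singleton] at hp
    have hT : T.card = 1 := by rcases hp.2 with rfl | rfl <;> simp
    exact mem_bipyramidFaces.2 ⟨I, T, hne I (by omega), hT.le, rfl, by simp [hp.1, hT]⟩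
  rcases Nat.lt_or_ge (k + 1) d with hkd | hkd
  · -- faces without an apex
    set B := Finset.powersetCard (k + 1) (Finset.univ : Finset (Fin d)) ×ˢ
      ({∅} : Finset (Finset Bool))
    have hB : B.card = d.choose (k + 1) := by simp [B]
    have hmemB : ∀ p ∈ B, p.1.disjSum p.2 ∈ bipyramidFaces d k := by
      rintro ⟨I, T⟩ hp
      simp only [B, Finset.mem_product, Finset.mem_powersetCard_univ, Finset.mem_singleton] at hp
      obtain ⟨hI, rfl⟩ := hp
      exact mem_bipyramidFaces.2 ⟨I, ∅, hne I (by omega), by simp, rfl, by simp [hI]⟩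
    have hAB : Disjoint A B := by
      rw [Finset.disjoint_left]
      rintro ⟨I, T⟩ h1 h2
      simp only [A, B, Finset.mem_product, Finset.mem_insert, Finset.mem_singleton] at h1 h2
      rw [h2.2] at h1
      simp at h1
    have hle := Finset.card_le_card (s := (A ∪ B).image fun p => p.1.disjSum p.2)
      (t := bipyramidFaces d k) (by
        intro J hJ
        obtain ⟨p, hp, rfl⟩ := Finset.mem_image.1 hJ
        rcases Finset.mem_union.1 hp with hp | hp
        · exact hmemA p hp
        · exact hmemB p hp)
    rw [Finset.card_image_of_injective _ hdisj, Finset.card_union_of_disjoint hAB, hA, hB] at hle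
    have := Nat.choose_pos hk.le
    rw [Nat.choose_succ_succ']
    omega
  · have hle := Finset.card_le_card (s := A.image fun p => p.1.disjSum p.2)
      (t := bipyramidFaces d k) (by
        intro J hJ
        obtain ⟨p, hp, rfl⟩ := Finset.mem_image.1 hJ
        exact hmemA p hp)
    rw [Finset.card_image_of_injective _ hdisj, hA] at hle
    obtain rfl : d = k + 1 := by omega
    rw [Nat.choose_symm_of_eq_add (n := k + 1) (a := k) (b := 1) rfl, Nat.choose_one_right] at hle
    rw [Nat.choose_symm_of_eq_add (n := k + 1 + 1) (a := k + 1) (b := 1) rfl, Nat.choose_one_right]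
    omega

/-- `d + 2` points near the vertices of a dilated bipyramid around the origin and all others near
the origin: each face of the bipyramid survives the perturbation. -/
lemma eventually_lt_faceCount (hd : 2 ≤ d) {k : ℕ} (hk : k < d) :
    ∀ᶠ δ : ℝ in 𝓝[>] 0, ∀ (n : ℕ) (x : Fin n → EuclideanSpace ℝ (Fin d)) (R : ℝ)
      (σ : Fin d ⊕ Bool ↪ Fin n), 0 < R →
      (∀ i, dist (x (σ i)) (R • configuration d (fun b => if b then 1 else -1) i) < R * δ) →
      (∀ j ∉ Set.range σ, ‖x j‖ < R * δ) →
      (d + 1).choose (k + 1) < faceCount k (polytope x) := by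
  classical
  set s : Bool → ℝ := fun b => if b then 1 else -1
  have hd' : (2 : ℝ) ≤ d := by exact_mod_cast hd
  have hface : ∀ J : bipyramidFaces d k, LinearIndependent ℝ (fun i : J.1 => configuration d s i) ∧
      ∃ l : EuclideanSpace ℝ (Fin d) →L[ℝ] ℝ,
        (∀ j ∈ J.1, l (configuration d s j) = 1) ∧ ∀ j ∉ J.1, l (configuration d s j) < 1 := by
    rintro ⟨J, hJ⟩
    obtain ⟨I, T, hI, hT, rfl, -⟩ := mem_bipyramidFaces.1 hJ
    refine ⟨linearIndependent_configuration (by intro t; cases t <;> simp [s]) I hT (Or.inl hI), ?_⟩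
    -- the coordinate sum is the sign of the apex, or zero if there is none
    have hsum : ∑ t ∈ T, s t < d := by
      have : ∑ t ∈ T, s t ≤ T.card • (1 : ℝ) :=
        Finset.sum_le_card_nsmul _ _ _ fun t _ => by cases t <;> simp [s]
      have hT' : (T.card : ℝ) ≤ 1 := by exact_mod_cast hT
      rw [nsmul_eq_mul, mul_one] at this
      linarith
    obtain ⟨l, hl₁, hl₂, hl₃⟩ := exists_functional_of_ne_univ s hI hsum
    have hT' : T = ∅ ∨ T = {true} ∨ T = {false} := by
      have : ∀ T : Finset Bool, T.card ≤ 1 → T = ∅ ∨ T = {true} ∨ T = {false} := by decide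
      exact this T hT
    refine ⟨l, ?_, ?_⟩
    · rintro (j | j) hj
      · exact hl₁ j (by simpa using hj)
      · rcases hT' with rfl | rfl | rfl <;> cases j <;> simp_all [s]
    · rintro (j | j) hj
      · exact hl₂ j (by simpa using hj)
      · rw [hl₃]
        rcases hT' with rfl | rfl | rfl <;> cases j <;> simp_all [s]
  choose hlin l₀ hl₁ hl₂ using hface
  have hev := eventually_all.2 fun J : bipyramidFaces d k =>
    eventually_radius_exists_functional (hlin J) (l₀ J) (hl₁ J) (hl₂ J)
  filter_upwards [hev] with δ hδ n x R σ hR hx hz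
  refine (choose_lt_card_bipyramidFaces hd hk).trans_le (card_le_faceCount σ _ (fun J hJ => ?_)
    (fun J hJ => ?_) fun J hJ => ?_)
  · obtain ⟨I, T, -, -, -, h⟩ := mem_bipyramidFaces.1 hJ
    exact h
  · obtain ⟨-, l, h₁, h₂, h₃⟩ := hδ ⟨J, hJ⟩ (fun j => x (σ j)) R hR hx
    refine ⟨l, 1, fun i hi => ?_, fun i hi => ?_⟩
    · obtain ⟨j, hj, rfl⟩ := Finset.mem_map.1 hi
      exact h₁ j hj
    · by_cases hr : i ∈ Set.range σ
      · obtain ⟨j, rfl⟩ := hr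
        exact h₂ j (by simpa using hi)
      · exact h₃ _ (hz i hr)
  · exact (hδ ⟨J, hJ⟩ (fun j => x (σ j)) R hR hx).1.affineIndependent ℝ

end Configurations

/-! ### Scaling of the beta-prime distribution -/

section Law

variable {d : ℕ} {β : ℝ}

lemma density_const_pos (hβ : (d : ℝ) / 2 < β) :
    0 < Real.Gamma β / (Real.pi ^ ((d : ℝ) / 2) * Real.Gamma (β - (d : ℝ) / 2)) := by
  have hd : (0 : ℝ) ≤ (d : ℝ) / 2 := by positivity
  have h1 := Real.Gamma_pos_of_pos (hd.trans_lt hβ)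
  have h2 := Real.Gamma_pos_of_pos (sub_pos.2 hβ)
  positivity

lemma density_pos (hβ : (d : ℝ) / 2 < β) (x : EuclideanSpace ℝ (Fin d)) : 0 < density d β x :=
  mul_pos (density_const_pos hβ) (by positivity)

lemma measurable_density (d : ℕ) (β : ℝ) : Measurable (density d β) := by
  unfold density
  fun_prop

lemma isFiniteMeasure_law (hβ : (d : ℝ) / 2 < β) : IsFiniteMeasure (law d β) := by
  refine isFiniteMeasure_withDensity_ofReal (Integrable.hasFiniteIntegral ?_)
  have h : Integrable (fun x : EuclideanSpace ℝ (Fin d) => (1 + ‖x‖ ^ 2) ^ (-(2 * β) / 2)) :=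
    integrable_rpow_neg_one_add_norm_sq (by
      rw [finrank_euclideanSpace_fin]
      linarith)
  have h2 : -(2 * β) / 2 = -β := by ring
  rw [h2] at h
  exact h.const_mul _

lemma law_real_ball_pos (hβ : (d : ℝ) / 2 < β) (y : EuclideanSpace ℝ (Fin d)) {δ : ℝ}
    (hδ : 0 < δ) : 0 < (law d β).real (Metric.ball y δ) := by
  have := isFiniteMeasure_law hβ
  refine ENNReal.toReal_pos (fun h0 => ?_) (measure_ne_top _ _)
  have hac : (volume : Measure (EuclideanSpace ℝ (Fin d))) ≪ law d β :=
    withDensity_absolutelyContinuous' (measurable_density d β).ennreal_ofReal.aemeasurable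
      (Eventually.of_forall fun x => by simpa using density_pos hβ x)
  exact (Metric.measure_ball_pos volume y hδ).ne' (hac h0)

lemma law_preimage_inv_smul (d : ℕ) (β : ℝ) {R : ℝ} (hR : 0 < R)
    {s : Set (EuclideanSpace ℝ (Fin d))} (hs : MeasurableSet s) :
    law d β ((fun x => R⁻¹ • x) ⁻¹' s) =
      ∫⁻ u in s, ENNReal.ofReal (R ^ d * density d β (R • u)) := by
  have hmeas := (measurable_density d β).ennreal_ofReal
  have hmeas' : Measurable fun u => ENNReal.ofReal (density d β (R • u)) :=
    hmeas.comp (measurable_const_smul R)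
  have hvol : (volume : Measure (EuclideanSpace ℝ (Fin d))) =
      ENNReal.ofReal (R ^ d) • Measure.map (fun x => R • x) volume := by
    rw [Measure.map_addHaar_smul _ hR.ne', smul_smul, finrank_euclideanSpace_fin,
      abs_of_nonneg (by positivity), ← ENNReal.ofReal_mul (by positivity),
      mul_inv_cancel₀ (by positivity), ENNReal.ofReal_one, one_smul]
  have hs' : MeasurableSet ((fun x : EuclideanSpace ℝ (Fin d) => R⁻¹ • x) ⁻¹' s) :=
    (measurable_const_smul R⁻¹) hs
  rw [law, withDensity_apply _ hs']
  conv_lhs => rw [hvol]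
  rw [Measure.restrict_smul, lintegral_smul_measure,
    setLIntegral_map hs' hmeas (measurable_const_smul R), smul_eq_mul,
    ← lintegral_const_mul _ hmeas']
  have hpre : (fun x : EuclideanSpace ℝ (Fin d) => R • x) ⁻¹' ((fun x => R⁻¹ • x) ⁻¹' s) = s := by
    ext u
    simp [smul_smul, inv_mul_cancel₀ hR.ne']
  rw [hpre]
  refine lintegral_congr fun u => ?_
  rw [ENNReal.ofReal_mul (by positivity)]

lemma rpow_sub_eq {R : ℝ} (hR : 0 < R) (d : ℕ) (β : ℝ) :
    R ^ ((d : ℝ) - 2 * β) = R ^ d * (R ^ 2) ^ (-β) := by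
  rw [← Real.rpow_natCast R d, ← Real.rpow_natCast R 2, ← Real.rpow_mul hR.le,
    ← Real.rpow_add hR]
  congr 1
  push_cast
  ring

/-- The dilation by `R ≥ 1` scales probabilities by at least the factor `R ^ (d - 2β)`. -/
lemma rpow_mul_law_le (hβ : (d : ℝ) / 2 < β) {R : ℝ} (hR : 1 ≤ R)
    {s : Set (EuclideanSpace ℝ (Fin d))} (hs : MeasurableSet s) :
    R ^ ((d : ℝ) - 2 * β) * (law d β).real s ≤
      (law d β).real ((fun x => R⁻¹ • x) ⁻¹' s) := by
  have := isFiniteMeasure_law hβ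
  have hR0 : 0 < R := by linarith
  have hβ0 : 0 < β := lt_of_le_of_lt (by positivity) hβ
  have hle : ENNReal.ofReal (R ^ ((d : ℝ) - 2 * β)) * law d β s ≤
      law d β ((fun x => R⁻¹ • x) ⁻¹' s) := by
    rw [law_preimage_inv_smul d β hR0 hs, law, withDensity_apply _ hs,
      ← lintegral_const_mul _ (measurable_density d β).ennreal_ofReal]
    refine lintegral_mono fun u => ?_
    rw [← ENNReal.ofReal_mul (by positivity)]
    refine ENNReal.ofReal_le_ofReal ?_
    rw [rpow_sub_eq hR0, mul_assoc]
    refine mul_le_mul_of_nonneg_left ?_ (by positivity)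
    rw [density, density, mul_left_comm]
    refine mul_le_mul_of_nonneg_left ?_ (density_const_pos hβ).le
    rw [← Real.mul_rpow (by positivity) (by positivity)]
    refine Real.rpow_le_rpow_of_nonpos (by positivity) ?_ (by linarith)
    rw [norm_smul, Real.norm_of_nonneg hR0.le]
    nlinarith
  have h := ENNReal.toReal_mono (measure_ne_top _ _) hle
  rwa [ENNReal.toReal_mul, ENNReal.toReal_ofReal (by positivity)] at h

/-- Away from the origin, the dilation by `R` scales probabilities by at most a constant multiple
of `R ^ (d - 2β)`. -/
lemma law_compl_ball_le (hβ : (d : ℝ) / 2 < β) {δ : ℝ} (hδ : 0 < δ) {R : ℝ} (hR : 0 < R) :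
    (law d β).real ((fun x => R⁻¹ • x) ⁻¹' (Metric.ball 0 δ)ᶜ) ≤
      R ^ ((d : ℝ) - 2 * β) * ((δ ^ 2 / (1 + δ ^ 2)) ^ (-β) * (law d β).real Set.univ) := by
  have := isFiniteMeasure_law hβ
  have hβ0 : 0 < β := lt_of_le_of_lt (by positivity) hβ
  set C := R ^ ((d : ℝ) - 2 * β) * (δ ^ 2 / (1 + δ ^ 2)) ^ (-β) with hC
  have hle : law d β ((fun x => R⁻¹ • x) ⁻¹' (Metric.ball 0 δ)ᶜ) ≤
      ENNReal.ofReal C * law d β (Metric.ball 0 δ)ᶜ := by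
    rw [law_preimage_inv_smul d β hR Metric.isOpen_ball.measurableSet.compl, law,
      withDensity_apply _ Metric.isOpen_ball.measurableSet.compl,
      ← lintegral_const_mul _ (measurable_density d β).ennreal_ofReal]
    refine setLIntegral_mono ((measurable_density d β).ennreal_ofReal.const_mul _) fun u hu => ?_
    rw [← ENNReal.ofReal_mul (by positivity)]
    refine ENNReal.ofReal_le_ofReal ?_
    have hu' : δ ≤ ‖u‖ := by simpa using hu
    rw [hC, rpow_sub_eq hR, mul_assoc, mul_assoc]
    refine mul_le_mul_of_nonneg_left ?_ (by positivity)
    rw [density, density, mul_left_comm _ (Real.Gamma β / _), mul_left_comm _ (Real.Gamma β / _)]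
    refine mul_le_mul_of_nonneg_left ?_ (density_const_pos hβ).le
    rw [← Real.mul_rpow (by positivity) (by positivity),
      ← Real.mul_rpow (by positivity) (by positivity)]
    refine Real.rpow_le_rpow_of_nonpos (by positivity) ?_ (by linarith)
    rw [norm_smul, Real.norm_of_nonneg hR.le]
    have h1 : δ ^ 2 / (1 + δ ^ 2) * (1 + ‖u‖ ^ 2) ≤ ‖u‖ ^ 2 := by
      rw [div_mul_eq_mul_div, div_le_iff₀ (by positivity)]
      nlinarith
    calc R ^ 2 * (δ ^ 2 / (1 + δ ^ 2) * (1 + ‖u‖ ^ 2)) ≤ R ^ 2 * ‖u‖ ^ 2 := by gcongr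
      _ ≤ 1 + (R * ‖u‖) ^ 2 := by rw [mul_pow]; linarith
  have h := ENNReal.toReal_mono (ENNReal.mul_ne_top ENNReal.ofReal_ne_top (measure_ne_top _ _)) hle
  rw [ENNReal.toReal_mul, ENNReal.toReal_ofReal (by positivity)] at h
  rw [← mul_assoc]
  exact h.trans (mul_le_mul_of_nonneg_left (measureReal_mono (Set.subset_univ _)) (by positivity))

end Law

/-! ### Configurations of extreme sample points occur with positive probability -/

section Probability

variable {d : ℕ} {β : ℝ}

lemma div_pow_le_choose {m n : ℕ} (hm : 1 ≤ m) (hmn : m ≤ n) :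
    ((n : ℝ) / m) ^ m / m.factorial ≤ n.choose m := by
  refine le_trans ?_ (Nat.pow_le_choose (α := ℝ) m n)
  have h : (n : ℝ) / m ≤ ((n + 1 - m : ℕ) : ℝ) := by
    have hm' : (1 : ℝ) ≤ m := by exact_mod_cast hm
    have hmn' : (m : ℝ) ≤ n := by exact_mod_cast hmn
    rw [div_le_iff₀ (by linarith), Nat.cast_sub (by omega)]
    push_cast
    nlinarith
  gcongr

/-- The events that exactly the sample points with indices in `S` fall outside `D` are disjoint
for different `S`. Summation over all `S` of size `card ι` bounds the probability that the sample
consists of one point in each of the sets `U i` and of points in `D`. -/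
lemma choose_mul_prod_mul_pow_le {Ω 𝓧 ι : Type*} [MeasurableSpace Ω] [MeasurableSpace 𝓧]
    [Fintype ι] {P : Measure Ω} [IsProbabilityMeasure P] {μ : Measure 𝓧} {n : ℕ}
    {X : Fin n → Ω → 𝓧} (hX : ∀ i, HasLaw (X i) μ P) (hind : iIndepFun X P) {U : ι → Set 𝓧} {D : Set 𝓧}
    (hU : ∀ i, MeasurableSet (U i)) (hD : MeasurableSet D) (hUD : ∀ i, Disjoint (U i) D) :
    (n.choose (Fintype.card ι) : ℝ) *
        ((∏ i, μ.real (U i)) * μ.real D ^ (n - Fintype.card ι)) ≤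
      P.real {ω | ∃ σ : ι ↪ Fin n, (∀ i, X (σ i) ω ∈ U i) ∧ ∀ j ∉ Set.range σ, X j ω ∈ D} := by
  classical
  have hlaw : ∀ j (s : Set 𝓧), MeasurableSet s → P.real (X j ⁻¹' s) = μ.real s := fun j s hs => by
    rw [measureReal_def, measureReal_def, ← (hX j).map_eq,
      Measure.map_apply_of_aemeasurable (hX j).aemeasurable hs]
  set 𝒮 := Finset.powersetCard (Fintype.card ι) (Finset.univ : Finset (Fin n)) with h𝒮
  have hcard𝒮 : 𝒮.card = n.choose (Fintype.card ι) := by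
    rw [h𝒮, Finset.card_powersetCard, Finset.card_univ, Fintype.card_fin]
  have he : ∀ S : 𝒮, ∃ e : ι ↪ Fin n, Finset.univ.map e = S.1 := fun S => by
    have hcard : Fintype.card ι = Fintype.card S.1 := by
      rw [Fintype.card_coe]
      exact (Finset.mem_powersetCard.1 S.2).2.symm
    refine ⟨(Fintype.equivOfCardEq hcard).toEmbedding.trans (Function.Embedding.subtype _), ?_⟩
    ext j
    simp only [Finset.mem_map, Finset.mem_univ, true_and]
    refine ⟨fun ⟨i, hi⟩ => hi ▸ ((Fintype.equivOfCardEq hcard) i).2, fun hj => ?_⟩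
    exact ⟨(Fintype.equivOfCardEq hcard).symm ⟨j, hj⟩, by simp⟩
  choose e he using he
  have hemem : ∀ S i, e S i ∈ S.1 := fun S i =>
    he S ▸ Finset.mem_map_of_mem _ (Finset.mem_univ i)
  have hex : ∀ S : 𝒮, ∀ j ∈ S.1, ∃ i, e S i = j := fun S j hj => by
    rw [← he S] at hj
    simpa using hj
  have hB : ∀ S : 𝒮, ∃ B : Fin n → Set 𝓧, (∀ i, B (e S i) = U i) ∧ (∀ j ∉ S.1, B j = D) ∧
      ∀ j, MeasurableSet (B j) := fun S => by
    refine ⟨Function.extend (e S) U fun _ => D, fun i => (e S).injective.extend_apply _ _ i,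
      fun j hj => Function.extend_apply' _ _ _ ?_, fun j => ?_⟩
    · rintro ⟨i, rfl⟩
      exact hj (hemem S i)
    · by_cases hj : ∃ i, e S i = j
      · obtain ⟨i, rfl⟩ := hj
        rw [(e S).injective.extend_apply]
        exact hU i
      · rw [Function.extend_apply' _ _ _ hj]
        exact hD
  choose B hB₁ hB₂ hBm using hB
  have hprob : ∀ S : 𝒮, P.real (⋂ j ∈ (Finset.univ : Finset (Fin n)), X j ⁻¹' B S j) =
      (∏ i, μ.real (U i)) * μ.real D ^ (n - Fintype.card ι) := fun S => by
    have hcard : S.1.card = Fintype.card ι := (Finset.mem_powersetCard.1 S.2).2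
    have h1 : P.real (⋂ j ∈ (Finset.univ : Finset (Fin n)), X j ⁻¹' B S j) =
        ∏ j, μ.real (B S j) := by
      rw [measureReal_def, hind.measure_inter_preimage_eq_mul _ fun j _ => hBm S j,
        ENNReal.toReal_prod]
      exact Finset.prod_congr rfl fun j _ => hlaw j _ (hBm S j)
    have h2 : ∏ j ∈ S.1, μ.real (B S j) = ∏ i, μ.real (U i) := by
      rw [Finset.prod_congr (he S).symm fun j _ => rfl, Finset.prod_map]
      exact Finset.prod_congr rfl fun i _ => by rw [hB₁]
    have h3 : ∏ j ∈ S.1ᶜ, μ.real (B S j) = μ.real D ^ (n - Fintype.card ι) := by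
      rw [Finset.prod_congr rfl fun j hj => by rw [hB₂ S j (Finset.mem_compl.1 hj)],
        Finset.prod_const, Finset.card_compl, Fintype.card_fin, hcard]
    rw [h1, ← Finset.prod_mul_prod_compl S.1, h2, h3]
  have hmemB : ∀ (S : 𝒮) (ω : Ω), ω ∈ (⋂ j ∈ (Finset.univ : Finset (Fin n)), X j ⁻¹' B S j) →
      ∀ j, X j ω ∈ B S j := fun S ω hω j => by
    simp only [Set.mem_iInter] at hω
    exact hω j (Finset.mem_univ j)
  have hread : ∀ (S : 𝒮) (ω : Ω), ω ∈ (⋂ j ∈ (Finset.univ : Finset (Fin n)), X j ⁻¹' B S j) →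
      ∀ j, j ∈ S.1 ↔ X j ω ∉ D := fun S ω hω j => by
    have hj := hmemB S ω hω j
    constructor
    · intro hjS
      obtain ⟨i, rfl⟩ := hex S j hjS
      rw [hB₁] at hj
      exact Set.disjoint_left.1 (hUD i) hj
    · intro hjD
      by_contra hjS
      rw [hB₂ S j hjS] at hj
      exact hjD hj
  have hdisj : ((Finset.univ : Finset 𝒮) : Set 𝒮).PairwiseDisjoint
      fun S => ⋂ j ∈ (Finset.univ : Finset (Fin n)), X j ⁻¹' B S j := fun S _ S' _ hne => by
    refine Set.disjoint_left.2 fun ω hω hω' => hne (Subtype.ext ?_)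
    ext j
    rw [hread S ω hω, hread S' ω hω']
  have hEm : ∀ S ∈ (Finset.univ : Finset 𝒮), NullMeasurableSet
      (⋂ j ∈ (Finset.univ : Finset (Fin n)), X j ⁻¹' B S j) P := fun S _ =>
    NullMeasurableSet.biInter (Set.to_countable _) fun j _ =>
      (hX j).aemeasurable.nullMeasurableSet_preimage (hBm S j)
  have hsum := measureReal_biUnion_finset₀ hdisj.aedisjoint hEm
  rw [Finset.sum_congr rfl fun S _ => hprob S, Finset.sum_const, Finset.card_univ,
    Fintype.card_coe, hcard𝒮, nsmul_eq_mul] at hsum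
  rw [← hsum]
  refine measureReal_mono fun ω hω => ?_
  simp only [Set.mem_iUnion] at hω
  obtain ⟨S, -, hω⟩ := hω
  have hωj := hmemB S ω (by simpa only [Set.mem_iInter] using hω)
  refine ⟨e S, fun i => hB₁ S i ▸ hωj (e S i), fun j hj => ?_⟩
  rw [← hB₂ S j fun h => hj (hex S j h)]
  exact hωj j

lemma inv_smul_mem_ball_iff {R : ℝ} (hR : 0 < R) {δ : ℝ} {x z : EuclideanSpace ℝ (Fin d)} :
    R⁻¹ • x ∈ Metric.ball z δ ↔ dist x (R • z) < R * δ := by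
  have : dist x (R • z) = R * dist (R⁻¹ • x) z := by
    conv_lhs => rw [← smul_inv_smul₀ hR.ne' x]
    rw [dist_smul₀, Real.norm_of_nonneg hR.le]
  rw [this, mul_lt_mul_iff_right₀ hR, Metric.mem_ball]

lemma half_le_one_sub_pow {n k : ℕ} (hn : 1 ≤ n) (hk : k ≤ n) :
    (1 / 2 : ℝ) ≤ (1 - 1 / (2 * n)) ^ k := by
  have hn1 : (1 : ℝ) ≤ n := by exact_mod_cast hn
  have h1 : 1 / (2 * n : ℝ) ≤ 1 := by
    rw [div_le_one (by positivity)]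
    linarith
  calc (1 / 2 : ℝ) = 1 + n * (-(1 / (2 * n))) := by field_simp; norm_num
    _ ≤ (1 + -(1 / (2 * n))) ^ n := one_add_mul_le_pow (by linarith) n
    _ = (1 - 1 / (2 * n)) ^ n := by rw [sub_eq_add_neg]
    _ ≤ (1 - 1 / (2 * n)) ^ k :=
        pow_le_pow_of_le_one (by linarith) (sub_le_self _ (by positivity)) hk

/-- The dilation factor `R`, of order `n ^ (1 / (2β - d))`, at which on average at most half a
sample point falls outside the ball of radius `R * δ`. -/
lemma exists_scale (hβ : (d : ℝ) / 2 < β) {δ : ℝ} (hδ : 0 < δ) :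
    ∃ A : ℝ, 1 ≤ A ∧ ∀ n : ℕ, 1 ≤ n → ∃ R : ℝ, 1 ≤ R ∧ R ^ ((d : ℝ) - 2 * β) = (A * n)⁻¹ ∧
      (law d β).real ((fun x => R⁻¹ • x) ⁻¹' (Metric.ball 0 δ)ᶜ) ≤ 1 / (2 * n) := by
  have hfin := isFiniteMeasure_law hβ
  obtain ⟨C, hC⟩ : ∃ C, C = (δ ^ 2 / (1 + δ ^ 2)) ^ (-β) * (law d β).real Set.univ := ⟨_, rfl⟩
  have hC0 : 0 ≤ C := by rw [hC]; positivity
  refine ⟨2 * C + 1, by linarith, fun n hn => ?_⟩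
  have hn1 : (1 : ℝ) ≤ n := by exact_mod_cast hn
  have hAn : 1 ≤ (2 * C + 1) * n := by nlinarith
  have hγ : 0 < 2 * β - d := by linarith
  have hR1 := Real.one_le_rpow hAn (inv_nonneg.2 hγ.le)
  have hRpow : (((2 * C + 1) * n) ^ ((2 * β - d)⁻¹)) ^ ((d : ℝ) - 2 * β) =
      ((2 * C + 1) * n)⁻¹ := by
    rw [← Real.rpow_mul (by positivity), ← neg_sub (2 * β), mul_neg, inv_mul_cancel₀ hγ.ne',
      Real.rpow_neg_one]
  refine ⟨_, hR1, hRpow, (law_compl_ball_le hβ hδ (by positivity)).trans ?_⟩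
  rw [hRpow, ← hC, inv_mul_le_iff₀ (by positivity), mul_one_div, le_div_iff₀ (by positivity)]
  nlinarith

/-- Fix a configuration `y` of points away from the origin. With probability bounded below
uniformly in the sample size, the sample consists of one point close to each point of a dilate of
`y` and of points close to the origin. -/
lemma exists_pos_le_measure_configuration (hβ : (d : ℝ) / 2 < β) {ι : Type*} [Fintype ι]
    [Nonempty ι] (y : ι → EuclideanSpace ℝ (Fin d)) {δ : ℝ} (hδ : 0 < δ)
    (hy : ∀ i, 2 * δ ≤ ‖y i‖) :
    ∃ p : ℝ, 0 < p ∧ ∀ n : ℕ, Fintype.card ι ≤ n → ∃ R : ℝ, 0 < R ∧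
      ∀ (Ω : Type*) [MeasurableSpace Ω] (P : Measure Ω) [IsProbabilityMeasure P]
        (X : Fin n → Ω → EuclideanSpace ℝ (Fin d)),
        (∀ i, HasLaw (X i) (law d β) P) → iIndepFun X P →
          p ≤ P.real {ω | ∃ σ : ι ↪ Fin n, (∀ i, dist (X (σ i) ω) (R • y i) < R * δ) ∧
            ∀ j ∉ Set.range σ, ‖X j ω‖ < R * δ} := by
  obtain ⟨A, hA1, hA⟩ := exists_scale hβ hδ
  obtain ⟨m, hmdef⟩ : ∃ m, m = Fintype.card ι := ⟨_, rfl⟩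
  have hm : 1 ≤ m := hmdef ▸ Fintype.card_pos
  obtain ⟨c, hc⟩ : ∃ c, c = ∏ i, (law d β).real (Metric.ball (y i) δ) := ⟨_, rfl⟩
  have hc0 : 0 < c := hc ▸ Finset.prod_pos fun i _ => law_real_ball_pos hβ (y i) hδ
  rw [← hmdef]
  refine ⟨(1 / (m * A)) ^ m / m.factorial * (c * (1 / 2)), by positivity, fun n hn => ?_⟩
  have hn1 : (1 : ℝ) ≤ n := by exact_mod_cast hm.trans hn
  obtain ⟨R, hR1, hRpow, hRcompl⟩ := hA n (hm.trans hn)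
  have hR : 0 < R := by linarith
  refine ⟨R, hR, fun Ω _ P _ X hX hind => ?_⟩
  have hf : Measurable fun x : EuclideanSpace ℝ (Fin d) => R⁻¹ • x := measurable_const_smul R⁻¹
  have hball : ∀ z, MeasurableSet
      ((fun x : EuclideanSpace ℝ (Fin d) => R⁻¹ • x) ⁻¹' Metric.ball z δ) :=
    fun z => hf Metric.isOpen_ball.measurableSet
  have hprob : IsProbabilityMeasure (law d β) := by
    have j : Fin n := ⟨0, by omega⟩
    rw [← (hX j).map_eq]
    exact Measure.isProbabilityMeasure_map (hX j).aemeasurable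
  have hsmall : 1 - 1 / (2 * n : ℝ) ≤
      (law d β).real ((fun x => R⁻¹ • x) ⁻¹' Metric.ball 0 δ) := by
    rw [Set.preimage_compl, probReal_compl_eq_one_sub (hball 0)] at hRcompl
    linarith
  have hlarge : c * ((A * n)⁻¹) ^ m ≤
      ∏ i, (law d β).real ((fun x => R⁻¹ • x) ⁻¹' Metric.ball (y i) δ) := by
    have h1 : c * ((A * n)⁻¹) ^ m = ∏ i, (A * n)⁻¹ * (law d β).real (Metric.ball (y i) δ) := by
      rw [Finset.prod_mul_distrib, Finset.prod_const, Finset.card_univ, mul_comm, hc, hmdef]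
    rw [h1]
    refine Finset.prod_le_prod (fun i _ => by positivity) fun i _ => ?_
    rw [← hRpow]
    exact rpow_mul_law_le hβ hR1 Metric.isOpen_ball.measurableSet
  have hdisj : ∀ i, Disjoint ((fun x => R⁻¹ • x) ⁻¹' Metric.ball (y i) δ)
      ((fun x => R⁻¹ • x) ⁻¹' Metric.ball 0 δ) := fun i =>
    (Metric.ball_disjoint_ball (by rw [dist_zero_right]; linarith [hy i])).preimage _
  have hmain := choose_mul_prod_mul_pow_le hX hind (fun i => hball (y i)) (hball 0)
    hdisj
  rw [← hmdef] at hmain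
  have h0 : (0 : ℝ) ≤ 1 - 1 / (2 * n) := by
    rw [sub_nonneg, div_le_one (by positivity)]
    linarith
  have hscale : (1 / (m * A)) ^ m = ((n : ℝ) / m) ^ m * ((A * n)⁻¹) ^ m := by
    rw [← mul_pow]
    congr 1
    field_simp
  have hfinal : P.real {ω | ∃ σ : ι ↪ Fin n,
      (∀ i, X (σ i) ω ∈ (fun x => R⁻¹ • x) ⁻¹' Metric.ball (y i) δ) ∧
        ∀ j ∉ Set.range σ, X j ω ∈ (fun x => R⁻¹ • x) ⁻¹' Metric.ball 0 δ} ≤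
      P.real {ω | ∃ σ : ι ↪ Fin n, (∀ i, dist (X (σ i) ω) (R • y i) < R * δ) ∧
            ∀ j ∉ Set.range σ, ‖X j ω‖ < R * δ} := by
    refine measureReal_mono ?_
    rintro ω ⟨σ, hσ, hz⟩
    refine ⟨σ, fun i => ?_, fun j hj => ?_⟩
    · have h : R⁻¹ • X (σ i) ω ∈ Metric.ball (y i) δ := hσ i
      exact (inv_smul_mem_ball_iff hR).1 h
    · have h : R⁻¹ • X j ω ∈ Metric.ball 0 δ := hz j hj
      simpa using (inv_smul_mem_ball_iff hR).1 h
  refine le_trans ?_ (hmain.trans hfinal)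
  have hstep : c * ((A * n)⁻¹) ^ m * (1 / 2) ≤
      (∏ i, (law d β).real ((fun x => R⁻¹ • x) ⁻¹' Metric.ball (y i) δ)) *
          (law d β).real ((fun x => R⁻¹ • x) ⁻¹' Metric.ball 0 δ) ^ (n - m) :=
    mul_le_mul hlarge ((half_le_one_sub_pow (hm.trans hn) (Nat.sub_le n m)).trans
      (pow_le_pow_left₀ h0 hsmall _)) (by norm_num)
      (Finset.prod_nonneg fun _ _ => measureReal_nonneg)
  have hnn : 0 ≤ c * ((A * n)⁻¹) ^ m * (1 / 2) := by positivity
  have hcoef : (1 / (m * A)) ^ m / m.factorial * (c * (1 / 2)) =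
      ((n : ℝ) / m) ^ m / m.factorial * (c * ((A * n)⁻¹) ^ m * (1 / 2)) := by
    rw [hscale]
    ring
  rw [hcoef]
  exact mul_le_mul (div_pow_le_choose hm hn) hstep hnn (Nat.cast_nonneg _)

end Probability

/-! ### The variance bound -/

section Variance

/-- A random variable that is at most `a`, and also at least `a + 1`, with probability at least `p`
deviates from its mean by `1 / 2` with probability at least `p`. -/
lemma div_four_le_variance {Ω : Type*} [MeasurableSpace Ω] {P : Measure Ω}
    [IsProbabilityMeasure P] {Y : Ω → ℝ} (hY : MemLp Y 2 P) {a p : ℝ}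
    (h₁ : p ≤ P.real {ω | Y ω ≤ a}) (h₂ : p ≤ P.real {ω | a + 1 ≤ Y ω}) :
    p / 4 ≤ variance Y P := by
  have hdev : p ≤ P.real {ω | 1 / 2 ≤ |Y ω - ∫ x, Y x ∂P|} := by
    rcases le_total (∫ x, Y x ∂P) (a + 1 / 2) with h | h
    · refine h₂.trans (measureReal_mono fun ω (hω : a + 1 ≤ Y ω) => ?_)
      exact le_trans (by linarith : 1 / 2 ≤ Y ω - ∫ x, Y x ∂P) (le_abs_self _)
    · refine h₁.trans (measureReal_mono fun ω (hω : Y ω ≤ a) => ?_)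
      exact le_trans (by linarith : 1 / 2 ≤ -(Y ω - ∫ x, Y x ∂P)) (neg_le_abs _)
  have hcheb := ENNReal.toReal_mono ENNReal.ofReal_ne_top
    (meas_ge_le_variance_div_sq hY (c := 1 / 2) (by norm_num))
  rw [ENNReal.toReal_ofReal (div_nonneg (variance_nonneg _ _) (by positivity))] at hcheb
  have : p ≤ variance Y P / (1 / 2) ^ 2 := hdev.trans hcheb
  norm_num at this
  linarith

lemma configuration_ne_zero {d : ℕ} (hd : 0 < d) {κ : Type*} {s : κ → ℝ} (hs : ∀ t, s t ≠ 0)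
    (i : Fin d ⊕ κ) : configuration d s i ≠ 0 := by
  rcases i with i | t
  · simp [configuration]
  · intro h
    have := congrArg (fun v : EuclideanSpace ℝ (Fin d) => v ⟨0, hd⟩) h
    exact hs t (by simpa [configuration] using this)

lemma eventually_two_mul_le_norm {d : ℕ} {ι : Type*} [Finite ι]
    {y : ι → EuclideanSpace ℝ (Fin d)} (hy : ∀ i, y i ≠ 0) :
    ∀ᶠ δ : ℝ in 𝓝[>] 0, ∀ i, 2 * δ ≤ ‖y i‖ :=
  eventually_all.2 fun i => by
    filter_upwards [Ioo_mem_nhdsGT (half_pos (norm_pos_iff.2 (hy i)))] with δ hδ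
    linarith [hδ.2]

end Variance

end BetaPrime

open BetaPrime in
theorem mainTheorem3 (d : ℕ) (hd : 2 ≤ d) (β : ℝ) (hβ : (d : ℝ) / 2 < β)
    (k : ℕ) (hk : k < d) :
    ∃ c : ℝ, 0 < c ∧ ∀ n : ℕ, d + 2 ≤ n →
      ∀ (Ω : Type*) [MeasurableSpace Ω] (P : Measure Ω) [IsProbabilityMeasure P]
        (X : Fin n → Ω → EuclideanSpace ℝ (Fin d)),
        (∀ i, HasLaw (X i) (BetaPrime.law d β) P) → iIndepFun X P →
          MemLp (fun ω => (BetaPrime.faceCount k (BetaPrime.polytope fun i => X i ω) : ℝ)) 2 P ∧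
          c ≤ variance
            (fun ω => (BetaPrime.faceCount k (BetaPrime.polytope fun i => X i ω) : ℝ)) P := by
  have hd0 : 0 < d := by omega
  obtain ⟨δ₁, ⟨hδ₁, hy₁⟩, hpos₁⟩ := (((eventually_faceCount_le hd0 hk).and
    (eventually_two_mul_le_norm (configuration_ne_zero hd0 (s := fun _ : Unit => (-1 : ℝ))
      (by simp)))).and self_mem_nhdsWithin).exists
  obtain ⟨δ₂, ⟨hδ₂, hy₂⟩, hpos₂⟩ := (((eventually_lt_faceCount hd hk).and
    (eventually_two_mul_le_norm (configuration_ne_zero hd0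
      (s := fun b : Bool => if b then (1 : ℝ) else -1) (by simp)))).and self_mem_nhdsWithin).exists
  obtain ⟨p₁, hp₁, h₁⟩ := exists_pos_le_measure_configuration hβ _ hpos₁ hy₁
  obtain ⟨p₂, hp₂, h₂⟩ := exists_pos_le_measure_configuration hβ _ hpos₂ hy₂
  refine ⟨min p₁ p₂ / 4, by positivity, fun n hn Ω _ P _ X hX hind => ?_⟩
  have hmem : MemLp (fun ω => (faceCount k (polytope fun i => X i ω) : ℝ)) 2 P := by
    have hXm : AEMeasurable (fun ω i => X i ω) P :=
      aemeasurable_pi_lambda _ fun i => (hX i).aemeasurable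
    refine MemLp.of_bound ?_ (2 ^ n) (Filter.Eventually.of_forall fun ω => ?_)
    · exact ((measurable_from_top (f := ((↑) : ℕ → ℝ))).comp
        (measurable_faceCount_polytope k n)).comp_aemeasurable hXm |>.aestronglyMeasurable
    · rw [Real.norm_of_nonneg (by positivity)]
      exact_mod_cast faceCount_polytope_le_two_pow k _
  refine ⟨hmem, div_four_le_variance hmem (a := (d + 1).choose (k + 1)) ?_ ?_⟩
  · obtain ⟨R, hR, h⟩ := h₁ n (by simp; omega)
    refine (min_le_left _ _).trans ((h Ω P X hX hind).trans (measureReal_mono ?_))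
    rintro ω ⟨σ, hσ, hz⟩
    exact Nat.cast_le (α := ℝ).2 (hδ₁ n (fun i => X i ω) R σ hR hσ hz)
  · obtain ⟨R, hR, h⟩ := h₂ n (by simp; omega)
    refine (min_le_right _ _).trans ((h Ω P X hX hind).trans (measureReal_mono ?_))
    rintro ω ⟨σ, hσ, hz⟩
    have := Nat.succ_le_of_lt (hδ₂ n (fun i => X i ω) R σ hR hσ hz)
    change (((d + 1).choose (k + 1) : ℕ) : ℝ) + 1 ≤ _
    exact_mod_cast this
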